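/- For a finite simple graph $G=(V,E)$ with $n=|V|$ and $S\subseteq V$, let $\Gamma^-(S)$ be the set of vertices outside $S$ that have a neighbour in $S$, and for $S'\subseteq S$ let $\Gamma^1_S(S')$ be the set of vertices outside $S$ that have exactly one neighbour in $S'$. For $\alpha,\beta>0$, $G$ is an $(\alpha,\beta)$-expander if $|\Gamma^-(S)|\ge\beta|S|$ for every $S\subseteq V$ with $|S|\le\alpha n$. For $\alpha n\ge 1$, the wireless expansion of $G$ (with respect to $\alpha$) is $$\beta_w(G)=\min\Bigl\{\max_{S'\subseteq S}\frac{|\Gamma^1_S(S')|}{|S|} \;:\; \emptyset\ne S\subseteq V,\ |S|\le\alpha n\Bigr\}.$$ Theorem. There are absolute constants $C,c>0$ such that the following hold. (1) For every integer $\Delta\ge1$ and every real $\beta$ with $1/\Delta\le\beta\le\Delta$ there exist $\alpha>0$ and an $(\alpha,\beta)$-expander $G$ with maximum degree exactly $\Delta$, on $n\geq 1/\alpha$ vertices, whose wireless expansion with respect to $\alpha$ satisfies $$\beta_w(G)\le C\cdot\frac{\beta}{\log_2\bigl(2\min\{\Delta/\beta,\ \Delta\beta\}\bigr)}.$$ (2)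 Moreover, for every integer $\Delta\ge1$, every real $\beta$ with $1/\Delta\le\beta\le c\Delta$ and every $\alpha$ with $0<\alpha\le c/(1+\beta)$, there is an integer $n_0\ge 1/\alpha$ such that for every $n\ge n_0$ there is an $n$-vertex $(\alpha,\beta)$-expander $G$ with maximum degree exactly $\Delta$ whose wireless expansion with respect to $\alpha$ satisfies the same bound, with the same constant $C$. -/

import Mathlib

namespace WirelessExpander

variable {V : Type*} [Fintype V]

open Classical in
/-- `Γ⁻(S)`: the vertices outside `S` with at least one neighbour in `S`. -/
noncomputable def extNbhd (G : SimpleGraph V) (S : Finset V) : Finset V :=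
  Finset.univ.filter fun v => v ∉ S ∧ ∃ u ∈ S, G.Adj u v

open Classical in
/-- `Γ¹_S(S')`, the `S`-excluding unique-neighbourhood of `S'`: the vertices outside `S`
with exactly one neighbour in `S'`. -/
noncomputable def uniqueNbhd (G : SimpleGraph V) (S S' : Finset V) : Finset V :=
  Finset.univ.filter fun v => v ∉ S ∧ ∃! u, u ∈ S' ∧ G.Adj u v

/-- `G` is an `(α, β)` vertex expander, for positive parameters `α` and `β`: every set `S` of at
most `α |V|` vertices has at least `β |S|` external neighbours. -/
def IsExpander (G : SimpleGraph V) (α β : ℝ) : Prop :=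
  0 < α ∧ 0 < β ∧
    ∀ S : Finset V, (S.card : ℝ) ≤ α * Fintype.card V →
      β * (S.card : ℝ) ≤ ((extNbhd G S).card : ℝ)

/-- The wireless expansion of a vertex set `S`: the maximum of `|Γ¹_S(S')| / |S|` over all
subsets `S'` of `S`. -/
noncomputable def setWirelessExpansion (G : SimpleGraph V) (S : Finset V) : ℝ :=
  S.powerset.sup' S.powerset_nonempty
    fun S' => ((uniqueNbhd G S S').card : ℝ) / (S.card : ℝ)

/-- The wireless expansion of the graph `G` at the size parameter `α`: the minimum wireless
expansion over all nonempty vertex sets `S` with `|S| ≤ α |V|`. (There are finitely many such sets;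
there is at least one as soon as `1 ≤ α |V|`.) -/
noncomputable def wirelessExpansion (G : SimpleGraph V) (α : ℝ) : ℝ :=
  sInf {r : ℝ | ∃ S : Finset V, S.Nonempty ∧ (S.card : ℝ) ≤ α * Fintype.card V ∧
    r = setWirelessExpansion G S}

end WirelessExpander

/-!
Two points of `{0, …, 2 ^ k - 1}` are compared at the scales `j = 0, …, k` through the dyadic
blocks of length `2 ^ j` containing them. In the bipartite graph joining `x` to `(j, y)` whenever
`x` and `y` share a block of length `2 ^ j`, each `x` reaches its own copies at all `k + 1` scales,
so a set `A` has at least `(k + 1) |A|` neighbours. Yet no `A` has more than `2 ^ (k + 1)` unique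
neighbours: if `A` has exactly one point in a block, then that point lies in one of the two halves
of the block and nothing below the other half is a unique neighbour. Wireless expansion thus loses
a factor of order `k` against ordinary expansion, and replicating both sides of the gadget tunes
the expansion to `β` and the degrees to `Δ`, with `k` of the order of
`log (min (Δ / β) (Δ * β))`.

The left side of the gadget is attached, as an independent set, to a graph on the remaining
vertices that expands by `2 β + 1` and is obtained from random permutations. A set is then either
mostly in the gadget or mostly outside it, and expands in both cases. Edges added away from the
left side raise the maximum degree to `Δ` without changing any unique neighbourhood there. When
`β` is comparable to `Δ`, the complete graph on `Δ + 1` vertices suffices.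
-/

namespace WirelessExpander

open Finset

section Neighbourhoods

variable {V : Type*} [Fintype V] {G : SimpleGraph V} {S S' : Finset V} {v : V}

@[simp]
theorem mem_extNbhd : v ∈ extNbhd G S ↔ v ∉ S ∧ ∃ u ∈ S, G.Adj u v := by
  simp [extNbhd]

@[simp]
theorem mem_uniqueNbhd : v ∈ uniqueNbhd G S S' ↔ v ∉ S ∧ ∃! u, u ∈ S' ∧ G.Adj u v := by
  simp [uniqueNbhd]

end Neighbourhoods

section Permutations

open scoped Pointwise

variable {V : Type*} [Fintype V] [DecidableEq V]

theorem card_perm_smul_subset_congr {X X' : Finset V} (h : #X = #X') (Y : Finset V) :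
    #{σ : Equiv.Perm V | σ • X ⊆ Y} = #{σ : Equiv.Perm V | σ • X' ⊆ Y} := by
  obtain ⟨τ, hτ⟩ := Equiv.Perm.exists_map_finset_eq X X' h
  have hτ' : X' = τ • X := by rw [← hτ, map_eq_image]; rfl
  refine card_equiv (Equiv.mulRight τ⁻¹) fun σ => ?_
  simp [hτ', mul_smul]

/-- Double counting of the pairs `(X', σ)` with `#X' = #X` and `σ • X' ⊆ Y`. -/
theorem card_perm_smul_subset_mul_choose (X Y : Finset V) :
    #{σ : Equiv.Perm V | σ • X ⊆ Y} * (Fintype.card V).choose #X =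
      (Fintype.card V).factorial * (#Y).choose #X := by
  have hfiber (σ : Equiv.Perm V) :
      #{X' ∈ powersetCard #X univ | σ • X' ⊆ Y} = (#Y).choose #X := by
    have : ({X' ∈ powersetCard #X univ | σ • X' ⊆ Y} : Finset (Finset V)) =
        powersetCard #X (σ⁻¹ • Y) := by
      ext X'
      simp [mem_powersetCard, smul_finset_subset_iff, and_comm]
    rw [this, card_powersetCard, card_smul_finset]
  calc #{σ : Equiv.Perm V | σ • X ⊆ Y} * (Fintype.card V).choose #X
      = ∑ X' ∈ powersetCard #X univ, #{σ : Equiv.Perm V | σ • X' ⊆ Y} := by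
        rw [sum_congr rfl fun X' hX' =>
          card_perm_smul_subset_congr (mem_powersetCard.1 hX').2 Y]
        simp [mul_comm]
    _ = ∑ σ : Equiv.Perm V, #{X' ∈ powersetCard #X univ | σ • X' ⊆ Y} :=
        sum_card_bipartiteAbove_eq_sum_card_bipartiteBelow _
    _ = (Fintype.card V).factorial * (#Y).choose #X := by
        simp [hfiber, Fintype.card_perm]

theorem descFactorial_mul_pow_le {y m : ℕ} (h : y ≤ m) (x : ℕ) :
    y.descFactorial x * m ^ x ≤ m.descFactorial x * y ^ x := by
  induction x with
  | zero => simp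
  | succ x ih =>
    have hfactor : (y - x) * m ≤ (m - x) * y := by
      rw [Nat.sub_mul, Nat.sub_mul, mul_comm m y]
      exact Nat.sub_le_sub_left (Nat.mul_le_mul_left x h) _
    calc y.descFactorial (x + 1) * m ^ (x + 1)
        = ((y - x) * m) * (y.descFactorial x * m ^ x) := by
          rw [Nat.descFactorial_succ, pow_succ]; ring
      _ ≤ ((m - x) * y) * (m.descFactorial x * y ^ x) := Nat.mul_le_mul hfactor ih
      _ = m.descFactorial (x + 1) * y ^ (x + 1) := by
          rw [Nat.descFactorial_succ, pow_succ]; ring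

theorem choose_mul_pow_le {y m : ℕ} (h : y ≤ m) (x : ℕ) :
    y.choose x * m ^ x ≤ m.choose x * y ^ x := by
  have := descFactorial_mul_pow_le h x
  rw [Nat.descFactorial_eq_factorial_mul_choose, Nat.descFactorial_eq_factorial_mul_choose,
    mul_assoc, mul_assoc] at this
  exact Nat.le_of_mul_le_mul_left this x.factorial_pos

theorem card_perm_smul_subset_le (X Y : Finset V) :
    (#{σ : Equiv.Perm V | σ • X ⊆ Y} : ℝ) ≤
      (Fintype.card V).factorial * ((#Y : ℝ) / Fintype.card V) ^ #X := by
  set m := Fintype.card V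
  rcases X.eq_empty_or_nonempty with rfl | hX
  · simp [m, Fintype.card_perm]
  have hXm : #X ≤ m := card_le_univ X
  have hm : (0 : ℝ) < m := by exact_mod_cast hX.card_pos.trans_le hXm
  have hchoose : (0 : ℝ) < m.choose #X := by exact_mod_cast Nat.choose_pos hXm
  have hcount : (#{σ : Equiv.Perm V | σ • X ⊆ Y} : ℝ) * m.choose #X =
      m.factorial * (#Y).choose #X := by
    exact_mod_cast card_perm_smul_subset_mul_choose X Y
  have hratio : ((#Y).choose #X : ℝ) * m ^ #X ≤ m.choose #X * #Y ^ #X := by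
    exact_mod_cast choose_mul_pow_le (card_le_univ Y) #X
  refine le_of_mul_le_mul_right ?_ hchoose
  calc (#{σ : Equiv.Perm V | σ • X ⊆ Y} : ℝ) * m.choose #X
      = m.factorial * (#Y).choose #X := hcount
    _ ≤ m.factorial * (m.choose #X * (#Y / m) ^ #X) := by
        gcongr
        rwa [div_pow, ← mul_div_assoc, le_div_iff₀ (by positivity)]
    _ = m.factorial * (#Y / m) ^ #X * m.choose #X := by ring

/-- First-moment method: the summand bounds the probability that all members of a uniformly
random family of permutations map `X k` into `Y k`. -/
theorem exists_perms_forall_exists_not_smul_subset {ι κ : Type*} [Fintype ι] (K : Finset κ)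
    (X Y : κ → Finset V)
    (hK : ∑ k ∈ K, ((#(Y k) : ℝ) / Fintype.card V) ^ (#(X k) * Fintype.card ι) < 1) :
    ∃ σ : ι → Equiv.Perm V, ∀ k ∈ K, ∃ i, ¬ σ i • X k ⊆ Y k := by
  classical
  set N : ℝ := ((Fintype.card V).factorial : ℝ) ^ Fintype.card ι
  have hN : 0 < N := by positivity
  let bad (k : κ) : Finset (ι → Equiv.Perm V) := Fintype.piFinset fun _ => {σ | σ • X k ⊆ Y k}
  have hbad (k : κ) :
      (#(bad k) : ℝ) ≤ N * ((#(Y k) : ℝ) / Fintype.card V) ^ (#(X k) * Fintype.card ι) := by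
    simp only [bad, Fintype.card_piFinset, prod_const, card_univ, Nat.cast_pow, N]
    rw [pow_mul, ← mul_pow]
    gcongr
    exact card_perm_smul_subset_le _ _
  have hunion : (#(K.biUnion bad) : ℝ) < #(univ : Finset (ι → Equiv.Perm V)) :=
    calc (#(K.biUnion bad) : ℝ) ≤ ∑ k ∈ K, (#(bad k) : ℝ) := by exact_mod_cast card_biUnion_le
      _ ≤ N * ∑ k ∈ K, ((#(Y k) : ℝ) / Fintype.card V) ^ (#(X k) * Fintype.card ι) := by
          rw [mul_sum]
          exact sum_le_sum fun k _ => hbad k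
      _ < N := mul_lt_of_lt_one_right hN hK
      _ = #(univ : Finset (ι → Equiv.Perm V)) := by simp [N, Fintype.card_perm]
  obtain ⟨σ, -, hσ⟩ := exists_mem_notMem_of_card_lt_card (Nat.cast_lt.1 hunion)
  refine ⟨σ, fun k hk => ?_⟩
  by_contra! hsub
  exact hσ (mem_biUnion.2 ⟨k, hk, by simpa [bad] using hsub⟩)

end Permutations

section Expander

theorem choose_le_exp_mul_div_pow (m : ℕ) {r : ℕ} (hr : 0 < r) :
    (m.choose r : ℝ) ≤ (Real.exp 1 * m / r) ^ r := by
  have hr' : (0 : ℝ) < r := by exact_mod_cast hr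
  calc (m.choose r : ℝ) ≤ (m : ℝ) ^ r / r.factorial := Nat.choose_le_pow_div r m
    _ = ((r : ℝ) ^ r / r.factorial) * ((m : ℝ) ^ r / (r : ℝ) ^ r) := by field_simp
    _ ≤ Real.exp r * ((m : ℝ) ^ r / (r : ℝ) ^ r) := by
        gcongr
        exact Real.pow_div_factorial_le_exp _ hr'.le r
    _ = (Real.exp 1 * m / r) ^ r := by
        rw [div_pow, mul_pow, ← Real.exp_nat_mul, mul_one, mul_div_assoc]

theorem choose_mul_choose_mul_pow_le {m x g : ℕ} (hx : 0 < x) (hg : 0 < g)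
    (hm : 24 * (g * x) ≤ m) :
    (m.choose x : ℝ) * m.choose (g * x) * (((g * x : ℕ) : ℝ) / m) ^ (x * (2 * (g + 1))) ≤
      (1 / 4) ^ x := by
  have hm0 : (0 : ℝ) < m := by exact_mod_cast (by positivity : 0 < 24 * (g * x)).trans_le hm
  set z : ℝ := ((g * x : ℕ) : ℝ) / m with hz
  have hz0 : 0 < z := by positivity
  have hz1 : z ≤ 1 / 24 := by
    rw [hz, div_le_iff₀ hm0, one_div_mul_eq_div, le_div_iff₀' (by norm_num)]
    exact_mod_cast hm
  have hez : 2 * (Real.exp 1 * z) ≤ 1 / 4 := by nlinarith [Real.exp_one_lt_three]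
  have hchoose_x : (m.choose x : ℝ) ≤ (g * (Real.exp 1 / z)) ^ x := by
    refine (choose_le_exp_mul_div_pow m hx).trans_eq ?_
    congr 1; rw [hz]; push_cast; field_simp
  have hchoose_gx : (m.choose (g * x) : ℝ) ≤ ((Real.exp 1 / z) ^ g) ^ x := by
    refine (choose_le_exp_mul_div_pow m (by positivity)).trans_eq ?_
    rw [pow_mul]; congr 2; rw [hz]; field_simp
  have hg2 : (g : ℝ) ≤ 2 ^ (g + 1) := by
    exact_mod_cast g.lt_two_pow_self.le.trans (Nat.pow_le_pow_right two_pos g.le_succ)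
  calc (m.choose x : ℝ) * m.choose (g * x) * z ^ (x * (2 * (g + 1)))
      ≤ (g * (Real.exp 1 / z)) ^ x * ((Real.exp 1 / z) ^ g) ^ x * z ^ (x * (2 * (g + 1))) := by
        gcongr
    _ = (g * (Real.exp 1 / z) ^ (g + 1) * (z ^ (g + 1) * z ^ (g + 1))) ^ x := by
        rw [mul_comm x, pow_mul, ← mul_pow, ← mul_pow, ← pow_add]
        congr 1
        rw [pow_succ (Real.exp 1 / z), two_mul]
        ring
    _ = (g * (Real.exp 1 * z) ^ (g + 1)) ^ x := by
        congr 1; rw [div_pow, mul_pow]; field_simp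
    _ ≤ (2 ^ (g + 1) * (Real.exp 1 * z) ^ (g + 1)) ^ x := by gcongr
    _ = ((2 * (Real.exp 1 * z)) ^ (g + 1)) ^ x := by rw [mul_pow 2]
    _ ≤ (1 / 4) ^ x := by
        gcongr
        exact (pow_le_of_le_one (by positivity) (by linarith) (by omega)).trans hez

open scoped Pointwise in
theorem exists_perms_expanding (V : Type*) [Fintype V] [DecidableEq V] {g : ℕ} (hg : 0 < g) :
    ∃ σ : Fin (2 * (g + 1)) → Equiv.Perm V, ∀ X Y : Finset V, X.Nonempty →
      24 * (g * #X) ≤ Fintype.card V → #Y = g * #X → ∃ i, ¬ σ i • X ⊆ Y := by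
  set m := Fintype.card V with hm
  let L := m / (24 * g)
  have hL (x : ℕ) : x ≤ L ↔ 24 * (g * x) ≤ m := by
    rw [Nat.le_div_iff_mul_le (by positivity), show x * (24 * g) = 24 * (g * x) by ring]
  let K : Finset (Σ _ : ℕ, Finset V × Finset V) := (Ico 1 (L + 1)).sigma fun x =>
    powersetCard x univ ×ˢ powersetCard (g * x) univ
  have hK : ∑ k ∈ K, ((#k.2.2 : ℝ) / m) ^ (#k.2.1 * Fintype.card (Fin (2 * (g + 1)))) < 1 :=
    calc ∑ k ∈ K, ((#k.2.2 : ℝ) / m) ^ (#k.2.1 * Fintype.card (Fin (2 * (g + 1))))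
        = ∑ x ∈ Ico 1 (L + 1), (m.choose x : ℝ) * m.choose (g * x) *
            (((g * x : ℕ) : ℝ) / m) ^ (x * (2 * (g + 1))) := by
          rw [sum_sigma]
          refine sum_congr rfl fun x _ => ?_
          rw [sum_congr rfl (g := fun _ => (((g * x : ℕ) : ℝ) / m) ^ (x * (2 * (g + 1))))]
          · simp [card_product, ← hm]
          · intro p hp
            obtain ⟨hX, hY⟩ := mem_product.1 hp
            rw [(mem_powersetCard.1 hX).2, (mem_powersetCard.1 hY).2, Fintype.card_fin]
      _ ≤ ∑ x ∈ Ico 1 (L + 1), ((1 : ℝ) / 4) ^ x := by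
          refine sum_le_sum fun x hx => ?_
          obtain ⟨hx1, hxL⟩ := mem_Ico.1 hx
          exact choose_mul_choose_mul_pow_le hx1 hg ((hL x).1 (Nat.lt_succ_iff.1 hxL))
      _ ≤ (1 / 4) ^ 1 / (1 - 1 / 4) := geom_sum_Ico_le_of_lt_one (by norm_num) (by norm_num)
      _ < 1 := by norm_num
  obtain ⟨σ, hσ⟩ := exists_perms_forall_exists_not_smul_subset K (·.2.1) (·.2.2) hK
  refine ⟨σ, fun X Y hX hXm hY => hσ ⟨#X, X, Y⟩ ?_⟩
  simp [K, Nat.one_le_iff_ne_zero, hX.ne_empty, hL, hXm, hY]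

/-- The graph in which every vertex is adjacent to its images under a family of permutations:
a Schreier graph, without its loops. -/
def permGraph {V ι : Type*} (σ : ι → Equiv.Perm V) : SimpleGraph V :=
  SimpleGraph.fromRel fun u v => ∃ i, σ i u = v

theorem degree_permGraph_le {V ι : Type*} [Fintype ι] (σ : ι → Equiv.Perm V) (v : V)
    [Fintype ((permGraph σ).neighborSet v)] :
    (permGraph σ).degree v ≤ 2 * Fintype.card ι := by
  classical
  have hsub : (permGraph σ).neighborFinset v ⊆
      univ.image (fun i => σ i v) ∪ univ.image (fun i => (σ i).symm v) := by
    intro w hw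
    rw [SimpleGraph.mem_neighborFinset, permGraph, SimpleGraph.fromRel_adj] at hw
    simp only [mem_union, mem_image, mem_univ, true_and, Equiv.symm_apply_eq]
    exact hw.2.imp id fun ⟨i, hi⟩ => ⟨i, hi.symm⟩
  calc (permGraph σ).degree v
      ≤ #(univ.image fun i => σ i v) + #(univ.image fun i => (σ i).symm v) :=
        (card_le_card hsub).trans (card_union_le _ _)
    _ ≤ 2 * Fintype.card ι := by
        rw [two_mul]
        exact add_le_add card_image_le card_image_le

open scoped Pointwise in
theorem smul_finset_subset_union_extNbhd_permGraph {V ι : Type*} [Fintype V] [DecidableEq V]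
    (σ : ι → Equiv.Perm V) (i : ι) (X : Finset V) :
    σ i • X ⊆ X ∪ extNbhd (permGraph σ) X := by
  intro w hw
  obtain ⟨v, hv, rfl⟩ := mem_smul_finset.1 hw
  by_cases hX : σ i • v ∈ X
  · exact mem_union_left _ hX
  · refine mem_union_right _ (mem_extNbhd.2 ⟨hX, v, hv, ?_⟩)
    rw [permGraph, SimpleGraph.fromRel_adj]
    exact ⟨fun h => hX (h ▸ hv), Or.inl ⟨i, rfl⟩⟩

theorem exists_mul_card_le_card_extNbhd (V : Type*) [Fintype V] (h : ℕ) :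
    ∃ H : SimpleGraph V,
      (∀ (v : V) [Fintype (H.neighborSet v)], H.degree v ≤ 4 * (h + 2)) ∧
      ∀ X : Finset V, 24 * ((h + 1) * #X) ≤ Fintype.card V → h * #X ≤ #(extNbhd H X) := by
  classical
  obtain ⟨σ, hσ⟩ := exists_perms_expanding V h.succ_pos
  refine ⟨permGraph σ, fun v _ => ?_, fun X hX => ?_⟩
  · refine (degree_permGraph_le σ v).trans ?_
    rw [Fintype.card_fin]; omega
  · rcases X.eq_empty_or_nonempty with rfl | hne
    · simp
    by_contra! hlt
    have hcard : #(X ∪ extNbhd (permGraph σ) X) ≤ (h + 1) * #X := by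
      rw [add_one_mul]
      exact (card_union_le _ _).trans (by omega)
    obtain ⟨Y, hY, hYcard⟩ := exists_superset_card_eq hcard (by omega)
    obtain ⟨i, hi⟩ := hσ X Y hne hX hYcard
    exact hi ((smul_finset_subset_union_extNbhd_permGraph σ i X).trans hY)

theorem exists_isExpander_degree_le (V : Type*) [Fintype V] {β : ℝ} (hβ : 0 < β) :
    ∃ H : SimpleGraph V, IsExpander H (1 / (24 * (β + 2))) β ∧
      ∀ (v : V) [Fintype (H.neighborSet v)], (H.degree v : ℝ) ≤ 4 * (β + 3) := by
  obtain ⟨H, hdeg, hH⟩ := exists_mul_card_le_card_extNbhd V ⌈β⌉₊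
  have hceil : (⌈β⌉₊ : ℝ) ≤ β + 1 := (Nat.ceil_lt_add_one hβ.le).le
  refine ⟨H, ⟨by positivity, hβ, fun X hX => ?_⟩, fun v _ => ?_⟩
  · have hsmall : (24 : ℝ) * ((⌈β⌉₊ + 1) * #X) ≤ Fintype.card V := by
      rw [one_div_mul_eq_div, le_div_iff₀ (by positivity)] at hX
      calc (24 : ℝ) * ((⌈β⌉₊ + 1) * #X) ≤ 24 * ((β + 1 + 1) * #X) := by gcongr
        _ = #X * (24 * (β + 2)) := by ring
        _ ≤ Fintype.card V := hX
    calc β * #X ≤ ⌈β⌉₊ * #X := by gcongr; exact Nat.le_ceil β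
      _ ≤ #(extNbhd H X) := by exact_mod_cast hH X (by exact_mod_cast hsmall)
  · calc (H.degree v : ℝ) ≤ 4 * (⌈β⌉₊ + 2) := by exact_mod_cast hdeg v
      _ ≤ 4 * (β + 3) := by linarith

end Expander

section Coverage

variable {S N : Type*} [Fintype N] {Γ : S → Finset N} {A : Finset S}

open Classical in
/-- The points belonging to exactly one of the sets `Γ s`, `s ∈ A`. With `Γ` read as a bipartite
graph, this is the unique-neighbourhood of `A` on the side `N`. -/
noncomputable def uniquelyCovered (Γ : S → Finset N) (A : Finset S) : Finset N :=
  {v | ∃! s, s ∈ A ∧ v ∈ Γ s}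

@[simp]
theorem mem_uniquelyCovered {v : N} : v ∈ uniquelyCovered Γ A ↔ ∃! s, s ∈ A ∧ v ∈ Γ s := by
  simp [uniquelyCovered]

theorem uniquelyCovered_singleton (Γ : S → Finset N) (s : S) : uniquelyCovered Γ {s} = Γ s := by
  ext v
  simp only [mem_uniquelyCovered, mem_singleton]
  exact ⟨fun ⟨_, ⟨rfl, h⟩, _⟩ => h, fun h => ⟨s, ⟨rfl, h⟩, fun _ h' => h'.1⟩⟩

theorem uniquelyCovered_map {R : Type*} [Fintype R] (e : N ↪ R) (Γ : S → Finset N)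
    (A : Finset S) :
    uniquelyCovered (fun s => (Γ s).map e) A = (uniquelyCovered Γ A).map e := by
  ext v
  simp only [mem_uniquelyCovered, mem_map]
  constructor
  · rintro ⟨s, ⟨hs, t, ht, rfl⟩, huniq⟩
    exact ⟨t, ⟨s, ⟨hs, ht⟩, fun s' h => huniq s' ⟨h.1, t, h.2, rfl⟩⟩, rfl⟩
  · rintro ⟨t, ⟨s, ⟨hs, ht⟩, huniq⟩, rfl⟩
    refine ⟨s, ⟨hs, t, ht, rfl⟩, fun s' ⟨hs', t', ht', htt'⟩ => huniq s' ⟨hs', ?_⟩⟩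
    rwa [← e.injective htt']

end Coverage

section DyadicGadget

open Classical in
/-- Among the pairs `(j, y)` with `j ≤ k` and `y` in the `c`-th dyadic block of length `2 ^ k`,
those for which exactly one point `f s`, `s ∈ A`, lies in the dyadic block of length `2 ^ j`
around `y`. -/
noncomputable def uniqueHits {ι : Type*} (A : Set ι) (f : ι → ℕ) (k c : ℕ) : Finset (ℕ × ℕ) :=
  {t ∈ range (k + 1) ×ˢ Ico (c * 2 ^ k) ((c + 1) * 2 ^ k) |
    ∃! s, s ∈ A ∧ f s / 2 ^ t.1 = t.2 / 2 ^ t.1}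

theorem mem_Ico_mul_two_pow {c k y : ℕ} :
    y ∈ Ico (c * 2 ^ k) ((c + 1) * 2 ^ k) ↔ y / 2 ^ k = c := by
  rw [mem_Ico, ← Nat.le_div_iff_mul_le (by positivity), ← Nat.div_lt_iff_lt_mul (by positivity)]
  omega

theorem div_two_pow_succ_eq_iff {y k c : ℕ} :
    y / 2 ^ (k + 1) = c ↔ y / 2 ^ k = 2 * c ∨ y / 2 ^ k = 2 * c + 1 := by
  rw [pow_succ, ← Nat.div_div_eq_div_mul]
  omega

variable {ι : Type*} {A : Set ι} {f : ι → ℕ} {k c : ℕ}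

theorem mem_uniqueHits {j y : ℕ} :
    (j, y) ∈ uniqueHits A f k c ↔
      j ≤ k ∧ y / 2 ^ k = c ∧ ∃! s, s ∈ A ∧ f s / 2 ^ j = y / 2 ^ j := by
  simp only [uniqueHits, mem_filter, mem_product, mem_range, mem_Ico_mul_two_pow, Nat.lt_succ_iff,
    and_assoc]

theorem uniqueHits_eq_empty (h : ∀ s ∈ A, f s / 2 ^ k ≠ c) : uniqueHits A f k c = ∅ := by
  rw [eq_empty_iff_forall_notMem]
  rintro ⟨j, y⟩ hjy
  obtain ⟨hj, hy, s, ⟨hs, hsy⟩, -⟩ := mem_uniqueHits.1 hjy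
  refine h s hs ?_
  rw [← hy, ← Nat.add_sub_cancel' hj, pow_add, ← Nat.div_div_eq_div_mul,
    ← Nat.div_div_eq_div_mul, hsy]

theorem uniqueHits_succ_subset (A : Set ι) (f : ι → ℕ) (k c : ℕ) :
    uniqueHits A f (k + 1) c ⊆ uniqueHits A f k (2 * c) ∪ uniqueHits A f k (2 * c + 1) ∪
      {k + 1} ×ˢ Ico (c * 2 ^ (k + 1)) ((c + 1) * 2 ^ (k + 1)) := by
  rintro ⟨j, y⟩ hjy
  obtain ⟨hj, hy, huniq⟩ := mem_uniqueHits.1 hjy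
  simp only [mem_union, mem_product, mem_singleton, mem_Ico_mul_two_pow, mem_uniqueHits, huniq,
    hy, and_true]
  have := div_two_pow_succ_eq_iff.1 hy
  omega

theorem uniqueHits_succ_subset_of_not_existsUnique
    (h : ¬ ∃! s, s ∈ A ∧ f s / 2 ^ (k + 1) = c) :
    uniqueHits A f (k + 1) c ⊆ uniqueHits A f k (2 * c) ∪ uniqueHits A f k (2 * c + 1) := by
  rintro ⟨j, y⟩ hjy
  obtain ⟨hj, hy, huniq⟩ := mem_uniqueHits.1 hjy
  have hjk : j ≠ k + 1 := by
    rintro rfl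
    exact h (hy ▸ huniq)
  simp only [mem_union, mem_uniqueHits, huniq, and_true]
  have := div_two_pow_succ_eq_iff.1 hy
  omega

theorem uniqueHits_eq_empty_or_eq_empty (h : ∃! s, s ∈ A ∧ f s / 2 ^ (k + 1) = c) :
    uniqueHits A f k (2 * c) = ∅ ∨ uniqueHits A f k (2 * c + 1) = ∅ := by
  obtain ⟨s, ⟨-, hsc⟩, huniq⟩ := h
  rcases div_two_pow_succ_eq_iff.1 hsc with hs | hs
  · refine Or.inr (uniqueHits_eq_empty fun t ht htc => ?_)
    rw [huniq t ⟨ht, div_two_pow_succ_eq_iff.2 (Or.inr htc)⟩] at htc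
    omega
  · refine Or.inl (uniqueHits_eq_empty fun t ht htc => ?_)
    rw [huniq t ⟨ht, div_two_pow_succ_eq_iff.2 (Or.inl htc)⟩] at htc
    omega

theorem card_uniqueHits_le (A : Set ι) (f : ι → ℕ) (k c : ℕ) :
    #(uniqueHits A f k c) ≤ 2 ^ (k + 1) := by
  induction k generalizing c with
  | zero =>
    classical
    exact (card_filter_le _ _).trans (by simp)
  | succ k ih =>
    rw [pow_succ', two_mul]
    have hleft := ih (2 * c)
    have hright := ih (2 * c + 1)
    by_cases htop : ∃! s, s ∈ A ∧ f s / 2 ^ (k + 1) = c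
    · have hblock : #({k + 1} ×ˢ Ico (c * 2 ^ (k + 1)) ((c + 1) * 2 ^ (k + 1))) =
          2 ^ (k + 1) := by
        rw [card_product, card_singleton, Nat.card_Ico, one_mul, add_one_mul,
          Nat.add_sub_cancel_left]
      have hcard := (card_le_card (uniqueHits_succ_subset A f k c)).trans
        ((card_union_le _ _).trans (Nat.add_le_add_right (card_union_le _ _) _))
      rcases uniqueHits_eq_empty_or_eq_empty htop with h | h <;> rw [h, card_empty] at hcard <;>
        omega
    · have hcard := (card_le_card (uniqueHits_succ_subset_of_not_existsUnique htop)).trans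
        (card_union_le _ _)
      omega

/-- The dyadic gadget, a bipartite graph given by the neighbourhoods of its left vertices:
`(x, a)` is joined to `(j, y, b)` when `x` and `y` lie in the same dyadic block of length `2 ^ j`.
The labels `a` and `b` make `p` copies of each left and `q` copies of each right vertex. -/
def dyadicNbhd (k p q : ℕ) (s : Fin (2 ^ k) × Fin p) :
    Finset (Fin (k + 1) × Fin (2 ^ k) × Fin q) :=
  {t | (s.1 : ℕ) / 2 ^ (t.1 : ℕ) = (t.2.1 : ℕ) / 2 ^ (t.1 : ℕ)}

theorem card_uniquelyCovered_dyadicNbhd_le (k p q : ℕ) (A : Finset (Fin (2 ^ k) × Fin p)) :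
    #(uniquelyCovered (dyadicNbhd k p q) A) ≤ q * 2 ^ (k + 1) := by
  let T := uniqueHits (A : Set (Fin (2 ^ k) × Fin p)) (fun s => (s.1 : ℕ)) k 0
  have hT : #(uniquelyCovered (dyadicNbhd k p q) A) ≤ #(T ×ˢ (univ : Finset (Fin q))) := by
    refine card_le_card_of_injOn (fun t => (((t.1 : ℕ), (t.2.1 : ℕ)), t.2.2)) ?_ ?_
    · rintro ⟨j, y, b⟩ ht
      refine mem_product.2 ⟨mem_uniqueHits.2 ⟨j.is_le, Nat.div_eq_of_lt y.2, ?_⟩, mem_univ _⟩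
      simpa [dyadicNbhd] using ht
    · rintro ⟨j, y, b⟩ - ⟨j', y', b'⟩ - h
      simpa [Fin.ext_iff, and_assoc] using h
  calc #(uniquelyCovered (dyadicNbhd k p q) A) ≤ #T * q := by simpa using hT
    _ ≤ 2 ^ (k + 1) * q := Nat.mul_le_mul_right q (card_uniqueHits_le _ _ k 0)
    _ = q * 2 ^ (k + 1) := mul_comm _ _

theorem card_dyadicNbhd_le (k p q : ℕ) (s : Fin (2 ^ k) × Fin p) :
    #(dyadicNbhd k p q s) ≤ q * 2 ^ (k + 1) := by
  rw [← uniquelyCovered_singleton (dyadicNbhd k p q) s]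
  exact card_uniquelyCovered_dyadicNbhd_le k p q {s}

theorem mul_card_le_card_biUnion_dyadicNbhd (k p q : ℕ) (A : Finset (Fin (2 ^ k) × Fin p)) :
    (k + 1) * q * #A ≤ p * #(A.biUnion (dyadicNbhd k p q)) := by
  have hA : #A ≤ #(A.image Prod.fst) * p := by
    have hsub : A ⊆ A.image Prod.fst ×ˢ (univ : Finset (Fin p)) := fun s hs =>
      mem_product.2 ⟨mem_image_of_mem _ hs, mem_univ _⟩
    simpa using card_le_card hsub
  have hbiUnion : (k + 1) * (#(A.image Prod.fst) * q) ≤ #(A.biUnion (dyadicNbhd k p q)) := by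
    have hsub : (univ : Finset (Fin (k + 1))) ×ˢ A.image Prod.fst ×ˢ (univ : Finset (Fin q)) ⊆
        A.biUnion (dyadicNbhd k p q) := by
      rintro ⟨j, y, b⟩ ht
      simp only [mem_product, mem_univ, true_and, and_true] at ht
      obtain ⟨s, hs, rfl⟩ := mem_image.1 ht
      exact mem_biUnion.2 ⟨s, hs, by simp [dyadicNbhd]⟩
    simpa using card_le_card hsub
  calc (k + 1) * q * #A ≤ (k + 1) * q * (#(A.image Prod.fst) * p) := by gcongr
    _ = p * ((k + 1) * (#(A.image Prod.fst) * q)) := by ring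
    _ ≤ p * #(A.biUnion (dyadicNbhd k p q)) := by gcongr

end DyadicGadget

section Parameters

theorem exists_nat_div_approx {x : ℝ} (hx : 0 < x) :
    ∃ p q : ℕ, 0 < p ∧ (p = 1 ∨ q = 1) ∧ p ≤ x * q ∧ x * q ≤ 2 * p := by
  rcases le_total 1 x with h | h
  · have hpos : 0 < ⌊x⌋₊ := Nat.floor_pos.2 h
    have hone : (1 : ℝ) ≤ ⌊x⌋₊ := by exact_mod_cast hpos
    refine ⟨⌊x⌋₊, 1, hpos, Or.inr rfl, by simpa using Nat.floor_le hx.le, ?_⟩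
    push_cast
    linarith [Nat.lt_floor_add_one x]
  · have hlower : x⁻¹ ≤ ⌈x⁻¹⌉₊ := Nat.le_ceil _
    have hupper : (⌈x⁻¹⌉₊ : ℝ) < x⁻¹ + 1 := Nat.ceil_lt_add_one (by positivity)
    refine ⟨1, ⌈x⁻¹⌉₊, one_pos, Or.inl rfl, ?_, ?_⟩
    · calc ((1 : ℕ) : ℝ) = x * x⁻¹ := by rw [mul_inv_cancel₀ hx.ne', Nat.cast_one]
        _ ≤ x * ⌈x⁻¹⌉₊ := by gcongr
    · calc x * ⌈x⁻¹⌉₊ ≤ x * (x⁻¹ + 1) := by gcongr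
        _ = 1 + x := by field_simp
        _ ≤ 2 * (1 : ℕ) := by push_cast; linarith

theorem logb_two_mul_le {M : ℝ} (hM : 0 < M) {k : ℕ} (h : M ≤ 4 ^ (k + 1)) :
    Real.logb 2 (2 * M) ≤ 3 * (k + 1) := by
  calc Real.logb 2 (2 * M) ≤ Real.logb 2 (2 ^ (2 * k + 3)) := by
        refine Real.logb_le_logb_of_le (by norm_num) (by positivity) ?_
        calc 2 * M ≤ 2 * 4 ^ (k + 1) := by gcongr
          _ = 2 ^ (2 * k + 3) := by
            rw [show (4 : ℝ) = 2 ^ 2 by norm_num, ← pow_mul]; ring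
    _ = 2 * k + 3 := by
        rw [Real.logb_pow, Real.logb_self_eq_one (by norm_num)]; push_cast; ring
    _ ≤ 3 * (k + 1) := by linarith [(k.cast_nonneg : (0 : ℝ) ≤ k)]

theorem one_le_min_div_mul {Δ β : ℝ} (hβ : 0 < β) (h₁ : 1 ≤ Δ * β) (h₂ : β ≤ Δ) :
    1 ≤ min (Δ / β) (Δ * β) :=
  le_min ((one_le_div hβ).2 h₂) h₁

/-- The upper bound of the theorem on the wireless expansion, without its constant factor. -/
noncomputable def wirelessBound (Δ β : ℝ) : ℝ :=
  β / Real.logb 2 (2 * min (Δ / β) (Δ * β))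

theorem le_mul_wirelessBound {Δ β : ℝ} {k : ℕ} (hβ : 0 < β) (h₁ : 1 ≤ Δ * β) (h₂ : β ≤ Δ)
    (hk : Δ ≤ 4 ^ (k + 1) * β) : Δ ≤ 3 * (k + 1) * 4 ^ (k + 1) * wirelessBound Δ β := by
  have hM := one_le_min_div_mul hβ h₁ h₂
  have hlog : Real.logb 2 (2 * min (Δ / β) (Δ * β)) ≤ 3 * (k + 1) :=
    logb_two_mul_le (by linarith) ((min_le_left _ _).trans ((div_le_iff₀ hβ).2 hk))
  have hlog₀ : 0 < Real.logb 2 (2 * min (Δ / β) (Δ * β)) :=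
    Real.logb_pos (by norm_num) (by linarith)
  rw [wirelessBound, ← mul_div_assoc, le_div_iff₀ hlog₀]
  calc Δ * Real.logb 2 (2 * min (Δ / β) (Δ * β)) ≤ 4 ^ (k + 1) * β * (3 * (k + 1)) := by gcongr
    _ = 3 * (k + 1) * 4 ^ (k + 1) * β := by ring

theorem wirelessBound_nonneg {Δ β : ℝ} (hβ : 0 < β) (h₁ : 1 ≤ Δ * β) (h₂ : β ≤ Δ) :
    0 ≤ wirelessBound Δ β :=
  div_nonneg hβ.le (Real.logb_nonneg (by norm_num) (by linarith [one_le_min_div_mul hβ h₁ h₂]))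

theorem two_mul_two_pow_le {Δ M : ℝ} {k : ℕ} (hΔ : 4 ≤ Δ) (hM : M ≤ Δ) (hk : 4 ^ k ≤ M) :
    2 * 2 ^ k ≤ Δ := by
  have hsq : (2 ^ k : ℝ) ^ 2 ≤ Δ := by
    rw [← pow_mul, mul_comm k, pow_mul]; norm_num; linarith
  nlinarith

theorem eight_mul_two_pow_le {Δ β : ℝ} {k : ℕ} (hΔ : 0 ≤ Δ) (hβ : 0 ≤ β) (h : 64 * β ≤ Δ)
    (hk : 4 ^ k * β ≤ Δ) : 8 * β * 2 ^ k ≤ Δ := by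
  refine (pow_le_pow_iff_left₀ (by positivity) hΔ two_ne_zero).1 ?_
  calc (8 * β * 2 ^ k) ^ 2 = 64 * β * (4 ^ k * β) := by
        rw [mul_pow, ← pow_mul, mul_comm k, pow_mul]; norm_num; ring
    _ ≤ Δ * Δ := by gcongr
    _ = Δ ^ 2 := (sq Δ).symm

/-- The level `k` is about half of `logb 2 (min (Δ / β) (Δ * β))`, and `p / q` is about
`(k + 1) / (2 * β)`. -/
theorem exists_dyadic_parameters {Δ β : ℝ} (hβ : 0 < β) (h₁ : 1 ≤ Δ * β) (h₂ : 64 * β ≤ Δ)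
    (h₃ : 4 ≤ Δ) :
    ∃ k p q : ℕ, 0 < p ∧ 2 * β * p ≤ (k + 1) * q ∧ (q : ℝ) * 2 ^ (k + 1) ≤ Δ ∧
      2 * ((p : ℝ) * 2 ^ k) ≤ Δ ∧
      2 * (q : ℝ) ≤ 24 * wirelessBound Δ β * p := by
  set M := min (Δ / β) (Δ * β) with hM
  have hM₁ : 1 ≤ M := one_le_min_div_mul hβ h₁ (by linarith)
  have hMdiv : M * β ≤ Δ := (le_div_iff₀ hβ).1 (min_le_left _ _)
  have hMmul : M ≤ Δ * β := min_le_right _ _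
  have hMΔ : M ≤ Δ := by nlinarith
  obtain ⟨k, hk, hk'⟩ := exists_nat_pow_near hM₁ (by norm_num : (1 : ℝ) < 4)
  have hk₂ : (k : ℝ) + 1 ≤ 2 ^ k := by exact_mod_cast (Nat.lt_two_pow_self : k < 2 ^ k)
  have hΔ₂ : 2 * 2 ^ k ≤ Δ := two_mul_two_pow_le h₃ hMΔ hk
  have hΔ₈ : 8 * β * 2 ^ k ≤ Δ :=
    eight_mul_two_pow_le (by linarith) hβ.le h₂ ((mul_le_mul_of_nonneg_right hk hβ.le).trans hMdiv)
  have hlog : Real.logb 2 (2 * M) ≤ 3 * (k + 1) := logb_two_mul_le (by linarith) hk'.le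
  obtain ⟨p, q, hp, hpq, hlower, hupper⟩ :=
    exists_nat_div_approx (x := (k + 1) / (2 * β)) (by positivity)
  rw [div_mul_eq_mul_div, le_div_iff₀ (by positivity)] at hlower
  rw [div_mul_eq_mul_div, div_le_iff₀ (by positivity)] at hupper
  refine ⟨k, p, q, hp, by linarith, ?_, ?_, ?_⟩
  · rcases hpq with rfl | rfl
    · have hq : (q : ℝ) ≤ 4 * β := by
        push_cast at hupper
        nlinarith [(by positivity : (0 : ℝ) ≤ k * q)]
      calc (q : ℝ) * 2 ^ (k + 1) ≤ 4 * β * 2 ^ (k + 1) := by gcongr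
        _ = 8 * β * 2 ^ k := by ring
        _ ≤ Δ := hΔ₈
    · rw [pow_succ']; simpa using hΔ₂
  · rcases hpq with rfl | rfl
    · simpa using hΔ₂
    · refine le_of_mul_le_mul_right ?_ hβ
      calc 2 * ((p : ℝ) * 2 ^ k) * β = p * (2 * β) * 2 ^ k := by ring
        _ ≤ 2 ^ k * 2 ^ k := by gcongr; simpa using hlower.trans (by simpa using hk₂)
        _ = 4 ^ k := by rw [← mul_pow]; norm_num
        _ ≤ Δ * β := hk.trans hMmul
  · have hlog₀ : 0 < Real.logb 2 (2 * M) := Real.logb_pos (by norm_num) (by linarith)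
    rw [wirelessBound, ← hM, ← mul_div_assoc, div_mul_eq_mul_div, le_div_iff₀ hlog₀]
    calc 2 * (q : ℝ) * Real.logb 2 (2 * M) ≤ 2 * q * (3 * (k + 1)) := by gcongr
      _ ≤ 24 * β * p := by linarith

end Parameters

section Attach

/-- The graph `H` together with an independent set `S` whose vertices `s` are joined to `Γ s`. -/
def attachGraph {S R : Type*} (Γ : S → Finset R) (H : SimpleGraph R) : SimpleGraph (S ⊕ R) where
  Adj
    | .inl _, .inl _ => False
    | .inl s, .inr v => v ∈ Γ s
    | .inr v, .inl s => v ∈ Γ s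
    | .inr v, .inr w => H.Adj v w
  symm := ⟨by
    rintro (s | v) (t | w) h
    exacts [h, h, h, H.symm.symm _ _ h]⟩
  loopless := ⟨by
    rintro (s | v) h
    exacts [h, H.loopless.irrefl v h]⟩

variable {S R : Type*} {Γ : S → Finset R} {H : SimpleGraph R} {s t : S} {v w : R}

@[simp]
theorem not_attachGraph_adj_inl_inl : ¬ (attachGraph Γ H).Adj (.inl s) (.inl t) := id

@[simp]
theorem attachGraph_adj_inl_inr : (attachGraph Γ H).Adj (.inl s) (.inr v) ↔ v ∈ Γ s := Iff.rfl

@[simp]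
theorem attachGraph_adj_inr_inl : (attachGraph Γ H).Adj (.inr v) (.inl s) ↔ v ∈ Γ s := Iff.rfl

@[simp]
theorem attachGraph_adj_inr_inr : (attachGraph Γ H).Adj (.inr v) (.inr w) ↔ H.Adj v w := Iff.rfl

theorem degree_attachGraph_inl [Fintype ((attachGraph Γ H).neighborSet (.inl s))] :
    (attachGraph Γ H).degree (.inl s) = #(Γ s) := by
  rw [← SimpleGraph.card_neighborFinset_eq_degree, ← card_map .inr (s := Γ s)]
  congr 1
  ext (t | w) <;> simp

theorem degree_attachGraph_inr_le [Fintype S] [Fintype (H.neighborSet v)]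
    [Fintype ((attachGraph Γ H).neighborSet (.inr v))] :
    (attachGraph Γ H).degree (.inr v) ≤ Fintype.card S + H.degree v := by
  rw [← SimpleGraph.card_neighborFinset_eq_degree, ← SimpleGraph.card_neighborFinset_eq_degree,
    ← card_univ, ← card_disjSum]
  refine card_le_card ?_
  rintro (t | w) <;> simp

variable [Fintype S] [Fintype R]

theorem uniqueNbhd_attachGraph (A : Finset S) :
    uniqueNbhd (attachGraph Γ H) (univ.map .inl) (A.map .inl) =
      (uniquelyCovered Γ A).map .inr := by
  ext (t | w)
  · simp
  · simp [ExistsUnique]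

theorem card_extNbhd_le_card_extNbhd_attachGraph (X : Finset (S ⊕ R)) :
    #(extNbhd H X.toRight) ≤ #(extNbhd (attachGraph Γ H) X) := by
  rw [← card_map .inr (s := extNbhd H X.toRight)]
  refine card_le_card fun x hx => ?_
  obtain ⟨v, hv, rfl⟩ := mem_map.1 hx
  obtain ⟨hvX, u, hu, huv⟩ := mem_extNbhd.1 hv
  exact mem_extNbhd.2 ⟨fun h => hvX (mem_toRight.2 h), .inr u, mem_toRight.1 hu, huv⟩

theorem card_biUnion_le_card_extNbhd_attachGraph_add [DecidableEq R] (X : Finset (S ⊕ R)) :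
    #(X.toLeft.biUnion Γ) ≤ #(extNbhd (attachGraph Γ H) X) + #X.toRight := by
  classical
  rw [← card_map .inr (s := X.toLeft.biUnion Γ), ← card_map .inr (s := X.toRight)]
  refine (card_le_card fun x hx => ?_).trans (card_union_le _ _)
  obtain ⟨v, hv, rfl⟩ := mem_map.1 hx
  obtain ⟨s, hs, hsv⟩ := mem_biUnion.1 hv
  by_cases hvX : Sum.inr v ∈ X
  · exact mem_union_right _ (mem_map_of_mem _ (mem_toRight.2 hvX))
  · exact mem_union_left _ (mem_extNbhd.2 ⟨hvX, .inl s, mem_toLeft.1 hs, hsv⟩)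

theorem isExpander_attachGraph [DecidableEq R] {α α' β : ℝ} (hα : 0 < α) (hβ : 0 < β)
    (hΓ : ∀ A : Finset S, 2 * β * #A ≤ #(A.biUnion Γ)) (hH : IsExpander H α' (2 * β + 1))
    (hαα' : α * Fintype.card (S ⊕ R) ≤ α' * Fintype.card R) :
    IsExpander (attachGraph Γ H) α β := by
  refine ⟨hα, hβ, fun X hX => ?_⟩
  have hcard : (#X : ℝ) = #X.toLeft + #X.toRight := by
    exact_mod_cast X.card_toLeft_add_card_toRight.symm
  have hleft : 2 * β * #X.toLeft ≤ #(extNbhd (attachGraph Γ H) X) + #X.toRight :=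
    (hΓ X.toLeft).trans (by exact_mod_cast card_biUnion_le_card_extNbhd_attachGraph_add X)
  have hright : (2 * β + 1) * #X.toRight ≤ #(extNbhd (attachGraph Γ H) X) := by
    refine (hH.2.2 X.toRight ?_).trans
      (by exact_mod_cast card_extNbhd_le_card_extNbhd_attachGraph X)
    linarith [(Nat.cast_nonneg _ : (0 : ℝ) ≤ #X.toLeft)]
  rw [hcard]
  linarith

end Attach

section Degree

variable {V : Type*} [Fintype V] {G G' : SimpleGraph V}

theorem extNbhd_mono (h : G ≤ G') (S : Finset V) : extNbhd G S ⊆ extNbhd G' S := by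
  intro v hv
  obtain ⟨hvS, u, hu, huv⟩ := mem_extNbhd.1 hv
  exact mem_extNbhd.2 ⟨hvS, u, hu, h huv⟩

theorem IsExpander.mono {α β : ℝ} (hG : IsExpander G α β) (h : G ≤ G') : IsExpander G' α β :=
  ⟨hG.1, hG.2.1, fun S hS =>
    (hG.2.2 S hS).trans (by exact_mod_cast card_le_card (extNbhd_mono h S))⟩

theorem uniqueNbhd_congr {S S' : Finset V} (h : ∀ u ∈ S', ∀ v, G'.Adj u v ↔ G.Adj u v) :
    uniqueNbhd G' S S' = uniqueNbhd G S S' := by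
  ext v
  simp only [mem_uniqueNbhd]
  exact and_congr_right fun _ => existsUnique_congr fun u => and_congr_right fun hu => h u hu v

theorem degree_sup_edge_le {V : Type*} (G : SimpleGraph V) (a b v : V)
    [Fintype (G.neighborSet v)] [Fintype ((G ⊔ SimpleGraph.edge a b).neighborSet v)] :
    (G ⊔ SimpleGraph.edge a b).degree v ≤ G.degree v + 1 := by
  classical
  have hsub : (G ⊔ SimpleGraph.edge a b).neighborFinset v ⊆
      insert (if v = a then b else a) (G.neighborFinset v) := by
    intro w hw
    simp only [SimpleGraph.mem_neighborFinset, SimpleGraph.sup_adj, SimpleGraph.edge_adj] at hw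
    rw [mem_insert, SimpleGraph.mem_neighborFinset]
    rcases hw with h | ⟨⟨rfl, rfl⟩ | ⟨rfl, rfl⟩, hne⟩
    · exact Or.inr h
    · simp
    · simp [hne]
  exact (card_le_card hsub).trans (card_insert_le _ _)

theorem exists_notMem_ne_not_adj (G : SimpleGraph V) (T : Finset V) (a : V)
    [Fintype (G.neighborSet a)] (h : #T + G.degree a + 1 < Fintype.card V) :
    ∃ b ∉ T, b ≠ a ∧ ¬ G.Adj a b := by
  classical
  have hcard : #(T ∪ insert a (G.neighborFinset a)) < #(univ : Finset V) := by
    have := card_union_le T (insert a (G.neighborFinset a))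
    have := card_insert_le a (G.neighborFinset a)
    rw [SimpleGraph.card_neighborFinset_eq_degree] at this
    rw [card_univ]
    omega
  obtain ⟨b, -, hb⟩ := exists_mem_notMem_of_card_lt_card hcard
  simp only [mem_union, mem_insert, SimpleGraph.mem_neighborFinset, not_or] at hb
  exact ⟨b, hb.1, hb.2⟩

theorem exists_ge_maxDegree_eq [DecidableRel G.Adj] {Δ : ℕ} (T : Finset V)
    (hG : ∀ v, G.degree v ≤ Δ) (hT : #T + Δ < Fintype.card V) :
    ∃ (G' : SimpleGraph V) (_ : DecidableRel G'.Adj), G ≤ G' ∧ G'.maxDegree = Δ ∧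
      ∀ u ∈ T, ∀ v, G'.Adj u v ↔ G.Adj u v := by
  classical
  let P (G' : SimpleGraph V) : Prop :=
    (∀ v, G'.degree v ≤ Δ) ∧ ∀ u ∈ T, ∀ v, G'.Adj u v ↔ G.Adj u v
  have hPG : P G := ⟨fun v => by convert hG v, fun _ _ _ => Iff.rfl⟩
  obtain ⟨G', hle, ⟨hdeg, hagree⟩, hmax⟩ := Finite.exists_le_maximal hPG
  refine ⟨G', Classical.decRel _, hle, ?_, hagree⟩
  refine (G'.maxDegree_le_of_forall_degree_le _ fun v => by convert hdeg v).antisymm ?_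
  by_contra! hlt
  have hdeg' (v : V) : G'.degree v < Δ := (G'.degree_le_maxDegree v).trans_lt hlt
  obtain ⟨a, -, ha⟩ : ∃ a ∈ (univ : Finset V), a ∉ T :=
    exists_mem_notMem_of_card_lt_card (by rw [card_univ]; omega)
  obtain ⟨b, hb, hba, hab⟩ := exists_notMem_ne_not_adj G' T a (by have := hdeg' a; omega)
  have hP : P (G' ⊔ SimpleGraph.edge a b) := by
    refine ⟨fun v => by convert Nat.le_trans (degree_sup_edge_le G' a b v) (hdeg' v),
      fun u hu v => ?_⟩
    have hua : u ≠ a := fun h => ha (h ▸ hu)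
    have hub : u ≠ b := fun h => hb (h ▸ hu)
    simp [SimpleGraph.edge_adj, hua, hub, hagree u hu v]
  refine hab (hmax hP le_sup_left ?_)
  simp [SimpleGraph.edge_adj, hba.symm]

end Degree

section Isomorphism

variable {V W : Type*} [Fintype V] [Fintype W] {G : SimpleGraph V} {G' : SimpleGraph W}

theorem extNbhd_map (φ : G ≃g G') (S : Finset V) :
    extNbhd G' (S.map φ.toEquiv.toEmbedding) = (extNbhd G S).map φ.toEquiv.toEmbedding := by
  ext w
  obtain ⟨v, rfl⟩ := φ.toEquiv.surjective w
  have hadj (u : V) : G'.Adj (φ.toEquiv u) (φ.toEquiv v) ↔ G.Adj u v := φ.map_adj_iff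
  rw [mem_map_equiv, Equiv.symm_apply_apply, mem_extNbhd, mem_extNbhd,
    ← φ.toEquiv.exists_congr_right]
  simp only [mem_map_equiv, Equiv.symm_apply_apply, hadj]

theorem uniqueNbhd_map (φ : G ≃g G') (S S' : Finset V) :
    uniqueNbhd G' (S.map φ.toEquiv.toEmbedding) (S'.map φ.toEquiv.toEmbedding) =
      (uniqueNbhd G S S').map φ.toEquiv.toEmbedding := by
  ext w
  obtain ⟨v, rfl⟩ := φ.toEquiv.surjective w
  have hadj (u : V) : G'.Adj (φ.toEquiv u) (φ.toEquiv v) ↔ G.Adj u v := φ.map_adj_iff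
  rw [mem_map_equiv, Equiv.symm_apply_apply, mem_uniqueNbhd, mem_uniqueNbhd,
    ← φ.toEquiv.existsUnique_congr_right]
  simp only [mem_map_equiv, Equiv.symm_apply_apply, hadj]

theorem IsExpander.of_iso {α β : ℝ} (hG : IsExpander G α β) (φ : G ≃g G') :
    IsExpander G' α β := by
  refine ⟨hG.1, hG.2.1, fun S hS => ?_⟩
  obtain ⟨S, rfl⟩ := φ.toEquiv.finsetCongr.surjective S
  simp only [Equiv.finsetCongr_apply, extNbhd_map, card_map] at hS ⊢
  exact hG.2.2 S (by rwa [φ.card_eq])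

theorem setWirelessExpansion_map (φ : G ≃g G') (S : Finset V) :
    setWirelessExpansion G' (S.map φ.toEquiv.toEmbedding) = setWirelessExpansion G S := by
  refine le_antisymm (sup'_le _ _ fun S' hS' => ?_) (sup'_le _ _ fun S' hS' => ?_)
  · obtain ⟨S', hS'', rfl⟩ := subset_map_iff.1 (mem_powerset.1 hS')
    rw [uniqueNbhd_map, card_map, card_map]
    exact le_sup' (fun S' => (#(uniqueNbhd G S S') : ℝ) / #S) (mem_powerset.2 hS'')
  · refine le_sup'_of_le _ (mem_powerset.2 (map_subset_map.2 (mem_powerset.1 hS'))) ?_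
    rw [uniqueNbhd_map, card_map, card_map]

theorem wirelessExpansion_eq_of_iso (φ : G ≃g G') (α : ℝ) :
    wirelessExpansion G' α = wirelessExpansion G α := by
  unfold wirelessExpansion
  congr 1
  ext r
  rw [Set.mem_ofPred_eq, Set.mem_ofPred_eq, ← φ.toEquiv.finsetCongr.exists_congr_right]
  simp [setWirelessExpansion_map, φ.card_eq]

end Isomorphism

section WirelessExpansion

variable {V : Type*} [Fintype V] {G : SimpleGraph V} {α β : ℝ}

theorem wirelessExpansion_le {b : ℝ} {S : Finset V} (hS : S.Nonempty)
    (hSα : (#S : ℝ) ≤ α * Fintype.card V)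
    (h : ∀ S' ⊆ S, (#(uniqueNbhd G S S') : ℝ) ≤ b * #S) :
    wirelessExpansion G α ≤ b := by
  have hbdd : BddBelow {r : ℝ | ∃ S : Finset V, S.Nonempty ∧
      (#S : ℝ) ≤ α * Fintype.card V ∧ r = setWirelessExpansion G S} := by
    refine ⟨0, ?_⟩
    rintro _ ⟨S, -, -, rfl⟩
    exact le_sup'_of_le _ (empty_mem_powerset S) (by positivity)
  refine (csInf_le hbdd ⟨S, hS, hSα, rfl⟩).trans (sup'_le _ _ fun S' hS' => ?_)
  rw [div_le_iff₀ (by exact_mod_cast hS.card_pos)]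
  exact h S' (mem_powerset.1 hS')

theorem wirelessExpansion_le_maxDegree [DecidableRel G.Adj] (hα : 1 ≤ α * Fintype.card V) :
    wirelessExpansion G α ≤ G.maxDegree := by
  classical
  have : Nonempty V := by
    by_contra! h
    simp at hα
    linarith
  obtain ⟨v⟩ := this
  refine wirelessExpansion_le (singleton_nonempty v) (by simpa using hα) fun S' hS' => ?_
  have hsub : uniqueNbhd G {v} S' ⊆ G.neighborFinset v := by
    intro w hw
    obtain ⟨-, u, ⟨hu, huw⟩, -⟩ := mem_uniqueNbhd.1 hw
    rwa [mem_singleton.1 (hS' hu), ← SimpleGraph.mem_neighborFinset] at huw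
  have hcard : #(uniqueNbhd G {v} S') ≤ G.maxDegree :=
    (card_le_card hsub).trans (G.degree_le_maxDegree v)
  simpa using hcard

theorem isExpander_top (hα : 0 < α) (hβ : 0 < β) (h : α * (1 + β) ≤ 1) :
    IsExpander (⊤ : SimpleGraph V) α β := by
  classical
  refine ⟨hα, hβ, fun S hS => ?_⟩
  rcases S.eq_empty_or_nonempty with rfl | hne
  · simp
  have hext : extNbhd (⊤ : SimpleGraph V) S = Sᶜ := by
    ext v
    obtain ⟨u, hu⟩ := hne
    simp only [mem_extNbhd, SimpleGraph.top_adj, mem_compl, and_iff_left_iff_imp]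
    exact fun hv => ⟨u, hu, fun h => hv (h ▸ hu)⟩
  have hcard : (#S : ℝ) + #Sᶜ = Fintype.card V := by exact_mod_cast S.card_add_card_compl
  have : (#S : ℝ) * (1 + β) ≤ Fintype.card V :=
    calc (#S : ℝ) * (1 + β) ≤ α * Fintype.card V * (1 + β) := by gcongr
      _ = α * (1 + β) * Fintype.card V := by ring
      _ ≤ Fintype.card V := mul_le_of_le_one_left (by positivity) h
  rw [hext]
  linarith

end WirelessExpansion

section Assembly

theorem exists_isExpander_maxDegree_eq_sum {S R : Type*} [Fintype S] [Nonempty S] [Fintype R]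
    [DecidableEq R] {Γ : S → Finset R} {Δ : ℕ} {α β b : ℝ} (hα : 0 < α) (hβ : 0 < β)
    (hΓ : ∀ A : Finset S, 2 * β * #A ≤ #(A.biUnion Γ)) (hΓΔ : ∀ s, #(Γ s) ≤ Δ)
    (hb : ∀ A : Finset S, (#(uniquelyCovered Γ A) : ℝ) ≤ b * Fintype.card S)
    (hSΔ : Fintype.card S + (8 * β + 16) ≤ Δ) (hΔR : Δ < Fintype.card R)
    (hSα : Fintype.card S ≤ α * Fintype.card (S ⊕ R))
    (hαR : α * Fintype.card (S ⊕ R) ≤ 1 / (24 * (2 * β + 1 + 2)) * Fintype.card R) :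
    ∃ (G : SimpleGraph (S ⊕ R)) (_ : DecidableRel G.Adj),
      G.maxDegree = Δ ∧ IsExpander G α β ∧ wirelessExpansion G α ≤ b := by
  classical
  obtain ⟨H, hH, hHdeg⟩ := exists_isExpander_degree_le R (by positivity : 0 < 2 * β + 1)
  have hdeg (x : S ⊕ R) : (attachGraph Γ H).degree x ≤ Δ := by
    rcases x with s | v
    · exact degree_attachGraph_inl.trans_le (hΓΔ s)
    · have hinr : ((attachGraph Γ H).degree (.inr v) : ℝ) ≤ Fintype.card S + H.degree v := by
        exact_mod_cast degree_attachGraph_inr_le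
      have hle : ((attachGraph Γ H).degree (.inr v) : ℝ) ≤ Δ := by linarith [hHdeg v]
      exact_mod_cast hle
  obtain ⟨G, dec, hle, hmax, hagree⟩ := exists_ge_maxDegree_eq (univ.map .inl) hdeg
    (by simpa using hΔR)
  refine ⟨G, dec, hmax, (isExpander_attachGraph hα hβ hΓ hH hαR).mono hle, ?_⟩
  refine wirelessExpansion_le (S := univ.map .inl) (by simp) (by simpa using hSα) fun S' hS' => ?_
  obtain ⟨A, -, rfl⟩ := subset_map_iff.1 hS'
  rw [uniqueNbhd_congr fun u hu => hagree u (hS' hu), uniqueNbhd_attachGraph, card_map, card_map,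
    card_univ]
  exact hb A

theorem exists_isExpander_maxDegree_eq_fin {S N : Type*} [Fintype S] [Nonempty S] [Fintype N]
    [DecidableEq N] {Γ : S → Finset N} {Δ n : ℕ} {α β b : ℝ} (hα : 0 < α) (hβ : 0 < β)
    (hαβ : α ≤ 1 / 4096 / (1 + β))
    (hΓ : ∀ A : Finset S, 2 * β * #A ≤ #(A.biUnion Γ)) (hΓΔ : ∀ s, #(Γ s) ≤ Δ)
    (hb : ∀ A : Finset S, (#(uniquelyCovered Γ A) : ℝ) ≤ b * Fintype.card S)
    (hSΔ : Fintype.card S + (8 * β + 16) ≤ Δ) (hSα : Fintype.card S ≤ α * n)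
    (hn : 2 * Fintype.card S + Fintype.card N + Δ < n) :
    ∃ (G : SimpleGraph (Fin n)) (_ : DecidableRel G.Adj),
      G.maxDegree = Δ ∧ IsExpander G α β ∧ wirelessExpansion G α ≤ b := by
  classical
  obtain ⟨m, rfl⟩ := Nat.exists_eq_add_of_le (show Fintype.card S ≤ n by omega)
  obtain ⟨e⟩ : Nonempty (N ↪ Fin m) :=
    Function.Embedding.nonempty_of_card_le (by rw [Fintype.card_fin]; omega)
  have hcard : Fintype.card (S ⊕ Fin m) = Fintype.card S + m := by simp
  have hαm : α * (Fintype.card S + m : ℕ) ≤ 1 / (24 * (2 * β + 1 + 2)) * m := by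
    have hm : ((Fintype.card S + m : ℕ) : ℝ) ≤ 2 * m := by exact_mod_cast (by omega)
    calc α * (Fintype.card S + m : ℕ) ≤ 1 / 4096 / (1 + β) * (2 * m) := by gcongr
      _ = 1 / (2048 * (1 + β)) * m := by field_simp; ring
      _ ≤ 1 / (24 * (2 * β + 1 + 2)) * m := by gcongr 1 / ?_ * _; linarith
  have hmap (A : Finset S) : A.biUnion (fun s => (Γ s).map e) = (A.biUnion Γ).map e := by
    simp only [map_eq_image, biUnion_image]
  obtain ⟨G, dec, hmax, hG, hb'⟩ := exists_isExpander_maxDegree_eq_sum (b := b) (Δ := Δ)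
    (Γ := fun s => (Γ s).map e) hα hβ
    (fun A => by rw [hmap A, card_map]; exact hΓ A) (by simpa using hΓΔ)
    (fun A => by rw [uniquelyCovered_map, card_map]; exact hb A) hSΔ
    (by rw [Fintype.card_fin]; omega) (by rwa [hcard]) (by rwa [hcard, Fintype.card_fin])
  let φ := G.overFinIso hcard
  exact ⟨G.overFin hcard, Classical.decRel _, by rw [← hmax, φ.maxDegree_eq], hG.of_iso φ,
    (wirelessExpansion_eq_of_iso φ α).trans_le hb'⟩

theorem exists_gadget {Δ : ℕ} {β : ℝ} (hβ : 0 < β) (h₁ : 1 ≤ Δ * β) (h₂ : 64 * β ≤ Δ)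
    (h₃ : 4 ≤ Δ) :
    ∃ (S N : Type) (_ : Fintype S) (_ : Nonempty S) (_ : Fintype N) (_ : DecidableEq N)
      (Γ : S → Finset N), 2 * Fintype.card S ≤ Δ ∧ (∀ s, #(Γ s) ≤ Δ) ∧
      (∀ A : Finset S, 2 * β * #A ≤ #(A.biUnion Γ)) ∧
      ∀ A : Finset S, (#(uniquelyCovered Γ A) : ℝ) ≤ 24 * wirelessBound Δ β * Fintype.card S := by
  obtain ⟨k, p, q, hp, hexp, hq, hpk, hbound⟩ :=
    exists_dyadic_parameters hβ h₁ h₂ (by exact_mod_cast h₃)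
  have hcard : Fintype.card (Fin (2 ^ k) × Fin p) = p * 2 ^ k := by simp [mul_comm]
  have hp' : (0 : ℝ) < p := by exact_mod_cast hp
  refine ⟨Fin (2 ^ k) × Fin p, _, inferInstance, ⟨0, ⟨0, hp⟩⟩, inferInstance, inferInstance,
    dyadicNbhd k p q, ?_, fun s => (card_dyadicNbhd_le k p q s).trans (by exact_mod_cast hq),
    fun A => ?_, fun A => ?_⟩
  · rw [hcard]
    exact_mod_cast hpk
  · refine le_of_mul_le_mul_left ?_ hp'
    calc (p : ℝ) * (2 * β * #A) = 2 * β * p * #A := by ring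
      _ ≤ (k + 1) * q * #A := by gcongr
      _ ≤ p * #(A.biUnion (dyadicNbhd k p q)) := by
        exact_mod_cast mul_card_le_card_biUnion_dyadicNbhd k p q A
  · calc (#(uniquelyCovered (dyadicNbhd k p q) A) : ℝ) ≤ q * 2 ^ (k + 1) := by
          exact_mod_cast card_uniquelyCovered_dyadicNbhd_le k p q A
      _ = 2 * q * 2 ^ k := by ring
      _ ≤ 24 * wirelessBound Δ β * p * 2 ^ k := by gcongr
      _ = 24 * wirelessBound Δ β * Fintype.card (Fin (2 ^ k) × Fin p) := by
        rw [hcard]; push_cast; ring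

theorem exists_isExpander_wirelessExpansion_le_of_le_mul {Δ : ℕ} {β : ℝ} (k : ℕ) (hβ : 0 < β)
    (h₁ : 1 ≤ Δ * β) (h₂ : β ≤ Δ) (h₃ : Δ ≤ 4 ^ (k + 1) * β) {C : ℝ}
    (hC : 3 * (k + 1) * 4 ^ (k + 1) ≤ C) :
    ∃ (α : ℝ) (n : ℕ) (G : SimpleGraph (Fin n)) (_ : DecidableRel G.Adj),
      1 ≤ α * n ∧ G.maxDegree = Δ ∧ IsExpander G α β ∧
        wirelessExpansion G α ≤ C * wirelessBound Δ β := by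
  have hα : 1 / ((Δ : ℝ) + 1) * (Δ + 1 : ℕ) = 1 := by
    push_cast
    exact one_div_mul_cancel (by positivity)
  have hmax : (⊤ : SimpleGraph (Fin (Δ + 1))).maxDegree = Δ := by simp
  refine ⟨1 / (Δ + 1), Δ + 1, ⊤, inferInstance, hα.ge, hmax,
    isExpander_top (by positivity) hβ ?_, ?_⟩
  · rw [one_div_mul_eq_div]
    exact div_le_one_of_le₀ (by linarith) (by positivity)
  · refine (wirelessExpansion_le_maxDegree (by rw [Fintype.card_fin, hα])).trans ?_
    rw [hmax]
    have := wirelessBound_nonneg hβ h₁ h₂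
    exact (le_mul_wirelessBound hβ h₁ h₂ h₃).trans (by gcongr)

theorem exists_isExpander_wirelessExpansion_le {Δ : ℕ} {α β : ℝ} (hβ : 0 < β) (h₁ : 1 ≤ Δ * β)
    (h₂ : β ≤ 1 / 4096 * Δ) (hα : 0 < α) (hαβ : α ≤ 1 / 4096 / (1 + β)) {C : ℝ} (hC : 24 ≤ C) :
    ∃ n₀ : ℕ, ∀ n : ℕ, n₀ ≤ n →
      ∃ (G : SimpleGraph (Fin n)) (_ : DecidableRel G.Adj),
        1 ≤ α * n ∧ G.maxDegree = Δ ∧ IsExpander G α β ∧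
          wirelessExpansion G α ≤ C * wirelessBound Δ β := by
  have hΔ : (64 : ℝ) ≤ Δ := by nlinarith
  obtain ⟨S, N, _, _, _, _, Γ, hS, hΓΔ, hΓ, hb⟩ :=
    exists_gadget hβ h₁ (by linarith) (by exact_mod_cast (by linarith : (4 : ℝ) ≤ Δ))
  refine ⟨⌈Fintype.card S / α⌉₊ + (2 * Fintype.card S + Fintype.card N + Δ + 1), fun n hn => ?_⟩
  have hSα : Fintype.card S ≤ α * n := by
    rw [← div_le_iff₀' hα]
    exact Nat.ceil_le.1 (by omega)
  have hS₁ : (1 : ℝ) ≤ Fintype.card S := by exact_mod_cast Fintype.card_pos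
  have hSΔ : Fintype.card S + (8 * β + 16) ≤ Δ := by
    have : 2 * (Fintype.card S : ℝ) ≤ Δ := by exact_mod_cast hS
    linarith
  obtain ⟨G, dec, hmax, hG, hw⟩ :=
    exists_isExpander_maxDegree_eq_fin hα hβ hαβ hΓ hΓΔ hb hSΔ hSα (n := n) (by omega)
  refine ⟨G, dec, hS₁.trans hSα, hmax, hG, hw.trans ?_⟩
  have := wirelessBound_nonneg hβ h₁ (by linarith)
  gcongr

end Assembly

end WirelessExpander

theorem theorem2 :
    ∃ C c : ℝ, 0 < C ∧ 0 < c ∧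
      (∀ (Δ : ℕ) (β : ℝ), 1 ≤ Δ → 1 / (Δ : ℝ) ≤ β → β ≤ (Δ : ℝ) →
        ∃ (α : ℝ) (n : ℕ) (G : SimpleGraph (Fin n)) (_ : DecidableRel G.Adj),
          1 ≤ α * (n : ℝ) ∧ G.maxDegree = Δ ∧ WirelessExpander.IsExpander G α β ∧
          WirelessExpander.wirelessExpansion G α ≤
            C * (β / Real.logb 2 (2 * min ((Δ : ℝ) / β) ((Δ : ℝ) * β)))) ∧
      (∀ (Δ : ℕ) (β : ℝ), 1 ≤ Δ → 1 / (Δ : ℝ) ≤ β → β ≤ c * (Δ : ℝ) →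
        ∀ α : ℝ, 0 < α → α ≤ c / (1 + β) →
          ∃ n₀ : ℕ, ∀ n : ℕ, n₀ ≤ n →
            ∃ (G : SimpleGraph (Fin n)) (_ : DecidableRel G.Adj),
              1 ≤ α * (n : ℝ) ∧ G.maxDegree = Δ ∧ WirelessExpander.IsExpander G α β ∧
              WirelessExpander.wirelessExpansion G α ≤
                C * (β / Real.logb 2 (2 * min ((Δ : ℝ) / β) ((Δ : ℝ) * β)))) := by
  have hpos (Δ : ℕ) (β : ℝ) (hΔ : 1 ≤ Δ) (hβ : 1 / (Δ : ℝ) ≤ β) : 0 < β ∧ 1 ≤ Δ * β := by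
    have hΔ₀ : (0 : ℝ) < Δ := by exact_mod_cast hΔ
    exact ⟨lt_of_lt_of_le (by positivity) hβ, (div_le_iff₀' hΔ₀).1 hβ⟩
  refine ⟨18 * 4096, 1 / 4096, by norm_num, by norm_num, fun Δ β hΔ hβΔ hβ₂ => ?_,
    fun Δ β hΔ hβΔ hβ₂ α hα hαβ => ?_⟩ <;>
  obtain ⟨hβ, hΔβ⟩ := hpos Δ β hΔ hβΔ
  · rcases le_total β (1 / 4096 * Δ) with hsparse | hdense
    · obtain ⟨n₀, h⟩ := WirelessExpander.exists_isExpander_wirelessExpansion_le hβ hΔβ hsparse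
        (by positivity) le_rfl (C := 18 * 4096) (by norm_num)
      exact ⟨_, n₀, h n₀ le_rfl⟩
    · exact WirelessExpander.exists_isExpander_wirelessExpansion_le_of_le_mul 5 hβ hΔβ hβ₂
        (by norm_num; linarith) (by norm_num)
  · exact WirelessExpander.exists_isExpander_wirelessExpansion_le hβ hΔβ hβ₂ hα hαβ (by norm_num)
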